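/- Let $n\ge 1$. A convex body in $\mathbb{R}^n$ is a compact convex set with non-empty interior; $\mathrm{vol}$ denotes $n$-dimensional Lebesgue measure. For a convex body $K$ let $K^\star=\{y\in\mathbb{R}^n:\langle x,y\rangle\le 1\text{ for all }x\in K\}$ be its polar and $\mathrm{cs}(K)=\tfrac12(K-K)$ its central symmetral. For a closed convex set $L$ with the origin in its interior and $1\le i\le n$, let $\lambda_i(L)$ be the smallest $\lambda>0$ such that $\lambda L$ contains $i$ linearly independent points of $\mathbb{Z}^n$. (i) Every convex body $K\subset\mathbb{R}^n$ satisfies $$\mathrm{vol}(K)\le 2^n\prod_{i=1}^n\lambda_i(\mathrm{cs}(K)^\star),$$ and equality is attained by some convex body in $\mathbb{R}^n$. (ii) Every convex body $K\subset\mathbb{R}^n$ whose centroid $\frac1{\mathrm{vol}(K)}\int_K x\,dx$ is the origin satisfies $$\mathrm{vol}(K)\le \frac{(n+1)^n}{n!}\prod_{i=1}^n\lambda_i(K^\star),$$ and equality is attained by some convex body in $\mathbb{R}^n$ with centroid at the origin. (iii) There is no function $f:\mathbb{R}\to\mathbb{R}$ such that $\mathrm{vol}(K)\le f\big(\prod_{i=1}^n\lambda_i(K^\star)\big)$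 for all convex bodies $K\subset\mathbb{R}^n$ with the origin in their interior. -/

import Mathlib

namespace ConvexLattice

open scoped Pointwise

/-- `n`-dimensional Euclidean space. -/
abbrev E (n : ℕ) : Type := EuclideanSpace ℝ (Fin n)

/-- `K` has non-empty interior (Mathlib's `ConvexBody` only asks for a non-empty compact
convex set). -/
def IsFull {n : ℕ} (K : ConvexBody (E n)) : Prop :=
  (interior (K : Set (E n))).Nonempty

/-- The volume, i.e. the `n`-dimensional Lebesgue measure, of a set. -/
noncomputable def vol {n : ℕ} (S : Set (E n)) : ℝ :=
  (MeasureTheory.volume S).toReal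

/-- The integer lattice `ℤⁿ` in `ℝⁿ`. -/
def intLattice (n : ℕ) : Set (E n) :=
  {x | ∀ j, ∃ m : ℤ, x j = (m : ℝ)}

/-- The polar set `{y : ⟨x, y⟩ ≤ 1 for all x ∈ K}`. -/
def polar {n : ℕ} (K : Set (E n)) : Set (E n) :=
  {y | ∀ x ∈ K, inner ℝ x y ≤ 1}

/-- The central symmetral `(1/2)(K - K)`. -/
noncomputable def centralSymmetral {n : ℕ} (K : Set (E n)) : Set (E n) :=
  (1 / 2 : ℝ) • (K - K)

/-- The `i`-th successive minimum: the smallest `t > 0` such that `t K` contains `i` linearly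
independent points of `ℤⁿ`. (`Set.finrank ℝ s` is the dimension of the linear span of `s`.) -/
noncomputable def succMin {n : ℕ} (i : ℕ) (K : Set (E n)) : ℝ :=
  sInf {t : ℝ | 0 < t ∧ i ≤ Set.finrank ℝ ((t • K) ∩ intLattice n)}

/-- The product `λ₁(K) ⋯ λₙ(K)` of all successive minima. -/
noncomputable def succMinProd {n : ℕ} (K : Set (E n)) : ℝ :=
  ∏ i ∈ Finset.Icc 1 n, succMin i K

/-- The centroid `vol(K)⁻¹ ∫_K x dx`. -/
noncomputable def centroid {n : ℕ} (K : Set (E n)) : E n :=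
  (vol K)⁻¹ • ∫ x in K, x

end ConvexLattice

namespace ConvexLattice

open MeasureTheory Set
open scoped Pointwise ENNReal

/-! Let `a i` be independent lattice points with `⟨x, a i⟩ ≤ u i` on the relevant body. The map `z i
= ⟨x, a i⟩ / u i` has Jacobian at least `(∏ u i)⁻¹`, because a nonzero integer determinant has
absolute value at least 1 (`lintegral_comp_inner_div_le`). So it suffices to bound an integral over
the image of `K`, and then let `u i` decrease to the successive minima (`le_mul_succMinProd_polar`).

For (i) the image lies in a box of side 2. For (ii) it lies in `{z ≤ 1}`, and the centroid condition
gives `vol K = ∫_K (1 + ∑ z i)`; keeping only the positive part leaves the integral of an affine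
function over a simplex.

The cube and the centered simplex have the extremal volumes. Their products are at most 1, since
each `-e j` lies in the polar, and at least 1 by the inequalities themselves. The boxes `[-1, b]ⁿ`
with `b ≥ 1` keep product 1, which gives (iii). -/

/-! ### Moments of the corner simplex -/

/-- The simplex of nonnegative vectors with coordinate sum at most `t`. -/
def cornerSimplex (n : ℕ) (t : ℝ) : Set (Fin n → ℝ) :=
  {y | (∀ i, 0 ≤ y i) ∧ ∑ i, y i ≤ t}

theorem measurableSet_cornerSimplex (n : ℕ) (t : ℝ) : MeasurableSet (cornerSimplex n t) := by
  have h : IsClosed (cornerSimplex n t) := by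
    have h1 : cornerSimplex n t = (⋂ i, {y | 0 ≤ y i}) ∩ {y | ∑ i, y i ≤ t} := by
      ext y; simp [cornerSimplex]
    rw [h1]
    exact (isClosed_iInter fun i => isClosed_le (by fun_prop) (by fun_prop)).inter
      (isClosed_le (by fun_prop) (by fun_prop))
  exact h.measurableSet

theorem cons_mem_cornerSimplex {n : ℕ} {t u : ℝ} {y : Fin n → ℝ} :
    (Fin.cons u y : Fin (n + 1) → ℝ) ∈ cornerSimplex (n + 1) t ↔
      u ∈ Icc 0 t ∧ y ∈ cornerSimplex n (t - u) := by
  simp only [cornerSimplex, mem_ofPred_eq, Fin.forall_fin_succ, Fin.cons_zero, Fin.cons_succ,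
    Fin.sum_univ_succ, mem_Icc]
  constructor
  · rintro ⟨⟨h0, h1⟩, h2⟩
    have := Finset.sum_nonneg fun i (_ : i ∈ Finset.univ) => h1 i
    exact ⟨⟨h0, by linarith⟩, h1, by linarith⟩
  · rintro ⟨⟨h0, _⟩, h1, h2⟩
    exact ⟨⟨h0, h1⟩, by linarith⟩

theorem lintegral_sub_pow {t : ℝ} (ht : 0 ≤ t) {c : ℝ} (hc : 0 ≤ c) (m : ℕ) :
    ∫⁻ u in Icc 0 t, ENNReal.ofReal (c * (t - u) ^ m) =
      ENNReal.ofReal (c * (t ^ (m + 1) / (m + 1))) := by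
  rw [← ofReal_integral_eq_lintegral_ofReal]
  · rw [integral_Icc_eq_integral_Ioc, ← intervalIntegral.integral_of_le ht,
      intervalIntegral.integral_const_mul,
      intervalIntegral.integral_comp_sub_left (fun x => x ^ m) t, integral_pow]
    simp
  · exact Continuous.integrableOn_Icc (by fun_prop)
  · refine (ae_restrict_iff' measurableSet_Icc).2 (ae_of_all _ fun u hu => ?_)
    exact mul_nonneg hc (pow_nonneg (sub_nonneg.2 hu.2) _)

/-- Slicing at first coordinate `u` leaves a corner simplex of size `t - u` with the same form of
integrand, whence induction on `n`. The case `k = 0` gives volumes, `k = 1` the constant in (ii). -/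
theorem lintegral_cornerSimplex (n k : ℕ) {t : ℝ} (ht : 0 ≤ t) :
    ∫⁻ y in cornerSimplex n t, ENNReal.ofReal ((t - ∑ i, y i) ^ k) =
      ENNReal.ofReal ((k.factorial : ℝ) / ((n + k).factorial : ℝ) * t ^ (n + k)) := by
  induction n generalizing t with
  | zero =>
    have h : cornerSimplex 0 t = univ := by
      ext y; simp [cornerSimplex, ht]
    have hk : (k.factorial : ℝ) ≠ 0 := by positivity
    rw [h, Measure.restrict_univ, volume_pi, Measure.pi_of_empty _ (fun i => i.elim0),
      lintegral_dirac]
    simp [hk]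
  | succ n ih =>
    have hmeas : Measurable ((cornerSimplex (n + 1) t).indicator
        fun y => ENNReal.ofReal ((t - ∑ i, y i) ^ k)) :=
      Measurable.indicator (by fun_prop) (measurableSet_cornerSimplex _ _)
    have hmp := (volume_preserving_piFinSuccAbove (fun _ : Fin (n + 1) => ℝ) 0).symm
    rw [← lintegral_indicator (measurableSet_cornerSimplex _ _), ← hmp.lintegral_comp hmeas,
      Measure.volume_eq_prod]
    refine (lintegral_prod _ (hmeas.comp hmp.measurable).aemeasurable).trans ?_
    have key : ∀ u : ℝ, ∫⁻ y : Fin n → ℝ, (cornerSimplex (n + 1) t).indicator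
        (fun y => ENNReal.ofReal ((t - ∑ i, y i) ^ k))
          ((MeasurableEquiv.piFinSuccAbove (fun _ => ℝ) 0).symm (u, y)) =
        (Icc 0 t).indicator (fun u => ENNReal.ofReal
          ((k.factorial : ℝ) / ((n + k).factorial : ℝ) * (t - u) ^ (n + k))) u := by
      intro u
      by_cases hu : u ∈ Icc 0 t
      · rw [indicator_of_mem hu, ← ih (sub_nonneg.2 hu.2),
          ← lintegral_indicator (measurableSet_cornerSimplex _ _)]
        refine lintegral_congr fun y => ?_
        have e : (MeasurableEquiv.piFinSuccAbove (fun _ : Fin (n + 1) => ℝ) 0).symm (u, y) =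
          Fin.cons u y := by
            simp [MeasurableEquiv.piFinSuccAbove, Fin.consEquiv]
        rw [e]
        by_cases hy : y ∈ cornerSimplex n (t - u)
        · rw [indicator_of_mem hy, indicator_of_mem (cons_mem_cornerSimplex.2 ⟨hu, hy⟩)]
          simp [Fin.sum_univ_succ, sub_sub]
        · rw [indicator_of_notMem hy,
            indicator_of_notMem fun h => hy (cons_mem_cornerSimplex.1 h).2]
      · rw [indicator_of_notMem hu, ← lintegral_zero]
        refine lintegral_congr fun y => ?_
        have e : (MeasurableEquiv.piFinSuccAbove (fun _ : Fin (n + 1) => ℝ) 0).symm (u, y) =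
          Fin.cons u y := by
            simp [MeasurableEquiv.piFinSuccAbove, Fin.consEquiv]
        rw [e, indicator_of_notMem fun h => hu (cons_mem_cornerSimplex.1 h).1]
    refine (lintegral_congr key).trans ?_
    rw [lintegral_indicator measurableSet_Icc, lintegral_sub_pow ht (by positivity)]
    congr 1
    rw [show n + 1 + k = n + k + 1 by ring, Nat.factorial_succ]
    push_cast
    field_simp

theorem factorial_div_mul_succ_pow (n : ℕ) :
    ((Nat.factorial 1 : ℕ) : ℝ) / ((n + 1).factorial : ℝ) * ((n : ℝ) + 1) ^ (n + 1) =
      ((n : ℝ) + 1) ^ n / (n.factorial : ℝ) := by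
  rw [Nat.factorial_succ n, Nat.factorial_one]
  push_cast
  field_simp
  ring

/-! ### Independent lattice points and change of variables -/

/-- Greedy choice: the vectors already chosen span too small a space to contain the next set. -/
theorem exists_linearIndependent_of_le_finrank {V : Type*} [AddCommGroup V] [Module ℝ V]
    [FiniteDimensional ℝ V] (m : ℕ) (s : Fin m → Set V)
    (hs : ∀ i : Fin m, (i : ℕ) + 1 ≤ Set.finrank ℝ (s i)) :
    ∃ a : Fin m → V, LinearIndependent ℝ a ∧ ∀ i, a i ∈ s i := by
  induction m with
  | zero => exact ⟨fun i => i.elim0, linearIndependent_empty_type, fun i => i.elim0⟩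
  | succ m ih =>
    obtain ⟨a, ha, has⟩ := ih (fun i => s i.castSucc) fun i => hs i.castSucc
    have hex : ∃ b ∈ s (Fin.last m), b ∉ Submodule.span ℝ (range a) := by
      by_contra! h
      have h1 := Submodule.finrank_mono (Submodule.span_le.2 h)
      have h2 := finrank_span_eq_card ha
      have h3 := hs (Fin.last m)
      rw [Set.finrank] at h3
      simp at h2 h3
      omega
    obtain ⟨b, hb, hba⟩ := hex
    refine ⟨Fin.snoc a b, linearIndependent_finSnoc.2 ⟨ha, hba⟩, fun i => ?_⟩
    refine Fin.lastCases ?_ (fun i => ?_) i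
    · simpa using hb
    · simpa using has i

theorem one_le_abs_det_of_mem_intLattice {n : ℕ} {a : Fin n → E n} (ha : LinearIndependent ℝ a)
    (hz : ∀ i, a i ∈ intLattice n) :
    1 ≤ |(Matrix.of fun i j => a i j : Matrix (Fin n) (Fin n) ℝ).det| := by
  choose m hm using hz
  have hA : (Matrix.of fun i j => a i j : Matrix (Fin n) (Fin n) ℝ) =
      (Matrix.of m).map (Int.castRingHom ℝ) := by
    ext i j; simp [hm]
  have hne : (Matrix.of fun i j => a i j : Matrix (Fin n) (Fin n) ℝ).det ≠ 0 := by
    rw [← isUnit_iff_ne_zero, ← Matrix.isUnit_iff_isUnit_det,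
      ← Matrix.linearIndependent_rows_iff_isUnit]
    exact ha.map' (WithLp.linearEquiv 2 ℝ (Fin n → ℝ)).toLinearMap (LinearEquiv.ker _)
  rw [hA, ← RingHom.mapMatrix_apply, ← RingHom.map_det] at hne ⊢
  simp only [eq_intCast, ne_eq, Int.cast_eq_zero] at hne ⊢
  exact_mod_cast Int.one_le_abs hne

/-- Change of variables along independent lattice functionals, rescaled by `t`. -/
theorem lintegral_comp_inner_div_le {n : ℕ} {a : Fin n → E n} (ha : LinearIndependent ℝ a)
    (hz : ∀ i, a i ∈ intLattice n) {t : Fin n → ℝ} (ht : ∀ i, 0 < t i)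
    {h : (Fin n → ℝ) → ℝ≥0∞} (hh : Measurable h) :
    ∫⁻ x : E n, h (fun i => inner ℝ x (a i) / t i) ≤
      ENNReal.ofReal (∏ i, t i) * ∫⁻ z, h z := by
  set A : Matrix (Fin n) (Fin n) ℝ := Matrix.of fun i j => a i j
  set B : Matrix (Fin n) (Fin n) ℝ := Matrix.diagonal (fun i => (t i)⁻¹) * A
  have hdetA : 1 ≤ |A.det| := one_le_abs_det_of_mem_intLattice ha hz
  have hP : 0 < ∏ i, t i := Finset.prod_pos fun i _ => ht i
  have hdet : B.det = (∏ i, t i)⁻¹ * A.det := by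
    simp [B, Matrix.det_mul, Matrix.det_diagonal]
  have hB0 : B.det ≠ 0 := by
    rw [hdet]
    exact mul_ne_zero (inv_ne_zero hP.ne') (abs_pos.1 (by linarith))
  have hBx : ∀ x : E n, (fun i => inner ℝ x (a i) / t i) = Matrix.toLin' B (WithLp.ofLp x) := by
    intro x
    ext i
    rw [Matrix.toLin'_apply, ← Matrix.mulVec_mulVec, Matrix.mulVec_diagonal, div_eq_inv_mul,
      PiLp.inner_apply]
    simp [A, Matrix.mulVec, dotProduct]
  have hBm : Measurable (Matrix.toLin' B) :=
    (LinearMap.continuous_of_finiteDimensional _).measurable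
  calc ∫⁻ x : E n, h (fun i => inner ℝ x (a i) / t i)
      = ∫⁻ x : E n, h (Matrix.toLin' B (WithLp.ofLp x)) := by simp only [hBx]
    _ = ∫⁻ x : Fin n → ℝ, h (Matrix.toLin' B x) :=
        (PiLp.volume_preserving_ofLp (Fin n)).lintegral_comp (hh.comp hBm)
    _ = ∫⁻ z, h z ∂(Measure.map (Matrix.toLin' B) volume) := (lintegral_map hh hBm).symm
    _ = ENNReal.ofReal |B.det⁻¹| * ∫⁻ z, h z := by
        rw [Real.map_matrix_volume_pi_eq_smul_volume_pi hB0, lintegral_smul_measure, smul_eq_mul]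
    _ ≤ _ := by
        gcongr
        rw [hdet, mul_inv, inv_inv, abs_mul, abs_of_pos hP, abs_inv]
        exact mul_le_of_le_one_right hP.le (inv_le_one_of_one_le₀ hdetA)

/-! ### Successive minima of polars -/

section SuccMin

variable {n : ℕ} {S T : Set (E n)} {t : ℝ}

/-- The vectors `-e j` lie in `t • polar S`. Only lower bounds on coordinates enter, so bodies long
in the positive directions still have small minima. It also makes the sets defining `succMin`
nonempty, excluding the default value `sInf ∅ = 0`. -/
theorem le_finrank_smul_polar {i : ℕ} (hi : i ≤ n) (ht : 0 < t)
    (h : ∀ x ∈ S, ∀ j, -t ≤ x j) :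
    i ≤ Set.finrank ℝ ((t • polar S) ∩ intLattice n) := by
  set b : Fin n → E n := fun j => -EuclideanSpace.single j (1 : ℝ)
  have hb : LinearIndependent ℝ b := by
    have h1 := (EuclideanSpace.basisFun (Fin n) ℝ).toBasis.linearIndependent.map'
      (LinearEquiv.neg ℝ : E n ≃ₗ[ℝ] E n).toLinearMap (LinearEquiv.ker _)
    have h2 : (LinearEquiv.neg ℝ : E n ≃ₗ[ℝ] E n).toLinearMap ∘
        (EuclideanSpace.basisFun (Fin n) ℝ).toBasis = b := by
      ext j : 1
      simp [b]
    rwa [h2] at h1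
  have hsub : range b ⊆ (t • polar S) ∩ intLattice n := by
    rintro _ ⟨j, rfl⟩
    refine ⟨(mem_smul_set_iff_inv_smul_mem₀ ht.ne' _ _).2 fun x hx => ?_, fun k => ?_⟩
    · have := h x hx j
      rw [inner_smul_right, inv_mul_le_iff₀ ht]
      simp only [b, inner_neg_right, EuclideanSpace.inner_single_right]
      simp
      linarith
    · refine ⟨if k = j then -1 else 0, ?_⟩
      by_cases hk : k = j <;> simp [b, hk]
  calc i ≤ n := hi
    _ = Module.finrank ℝ (Submodule.span ℝ (range b)) := by
      rw [finrank_span_eq_card hb, Fintype.card_fin]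
    _ ≤ _ := Submodule.finrank_mono (Submodule.span_mono hsub)

theorem succMin_nonneg (i : ℕ) (S : Set (E n)) : 0 ≤ succMin i S :=
  Real.sInf_nonneg fun _ h => h.1.le

theorem succMin_polar_le {i : ℕ} (hi : i ≤ n) (ht : 0 < t)
    (h : ∀ x ∈ S, ∀ j, -t ≤ x j) : succMin i (polar S) ≤ t :=
  csInf_le ⟨0, fun _ h => h.1.le⟩ ⟨ht, le_finrank_smul_polar hi ht h⟩

theorem succMinProd_polar_le_one (h : ∀ x ∈ S, ∀ j, -1 ≤ x j) : succMinProd (polar S) ≤ 1 :=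
  Finset.prod_le_one (fun _ _ => succMin_nonneg _ _)
    fun _ hi => succMin_polar_le (Finset.mem_Icc.1 hi).2 one_pos h

theorem polar_anti (hST : S ⊆ T) : polar T ⊆ polar S := fun _ hy x hx => hy x (hST hx)

theorem succMinProd_polar_mono (hST : S ⊆ T) (ht : 0 < t) (h : ∀ x ∈ T, ∀ j, -t ≤ x j) :
    succMinProd (polar S) ≤ succMinProd (polar T) := by
  refine Finset.prod_le_prod (fun _ _ => succMin_nonneg _ _) fun i hi => ?_
  refine csInf_le_csInf ⟨0, fun _ h => h.1.le⟩
    ⟨t, ht, le_finrank_smul_polar (Finset.mem_Icc.1 hi).2 ht h⟩ fun u hu => ⟨hu.1, hu.2.trans ?_⟩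
  exact Submodule.finrank_mono (Submodule.span_mono
    (inter_subset_inter_left _ (smul_set_mono (polar_anti hST))))

/-- The slack `ε` makes it unnecessary to know that the infima are attained. Indices in `Fin n`
start at 0, hence `i + 1`. -/
theorem exists_linearIndependent_lt_succMin_add (ht : 0 < t) (h : ∀ x ∈ S, ∀ j, -t ≤ x j)
    {ε : ℝ} (hε : 0 < ε) :
    ∃ (a : Fin n → E n) (u : Fin n → ℝ), LinearIndependent ℝ a ∧ (∀ i, a i ∈ intLattice n) ∧
      (∀ i, 0 < u i) ∧ (∀ i, ∀ x ∈ S, inner ℝ x (a i) ≤ u i) ∧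
      ∀ i : Fin n, u i < succMin (i + 1) (polar S) + ε := by
  have hex : ∀ i : Fin n, ∃ u : ℝ,
      (0 < u ∧ (i : ℕ) + 1 ≤ Set.finrank ℝ ((u • polar S) ∩ intLattice n)) ∧
      u < succMin (i + 1) (polar S) + ε := fun i => by
    obtain ⟨u, hu, hlt⟩ := Real.lt_sInf_add_pos
      (s := {u : ℝ | 0 < u ∧ (i : ℕ) + 1 ≤ Set.finrank ℝ ((u • polar S) ∩ intLattice n)})
      ⟨t, ht, le_finrank_smul_polar i.2 ht h⟩ hε
    exact ⟨u, hu, hlt⟩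
  choose u hu hlt using hex
  obtain ⟨a, ha, has⟩ := exists_linearIndependent_of_le_finrank n
    (fun i => (u i • polar S) ∩ intLattice n) fun i => (hu i).2
  refine ⟨a, u, ha, fun i => (has i).2, fun i => (hu i).1, fun i x hx => ?_, hlt⟩
  obtain ⟨y, hy, hya⟩ := (has i).1
  rw [← hya]
  change inner ℝ x (u i • y) ≤ u i
  rw [inner_smul_right]
  exact mul_le_of_le_one_right (hu i).1.le (hy x hx)

theorem succMinProd_eq_prod_fin (S : Set (E n)) :
    succMinProd S = ∏ i : Fin n, succMin (i + 1) S := by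
  rw [succMinProd, ← Finset.prod_range fun i => succMin (i + 1) S, Finset.range_eq_Ico,
    Finset.prod_Ico_add' (fun i => succMin i S), ← Finset.Ico_add_one_right_eq_Icc]

/-- A bound by any admissible choice of independent lattice functionals gives a bound by the
successive minima. -/
theorem le_mul_succMinProd_polar (ht : 0 < t) (h : ∀ x ∈ S, ∀ j, -t ≤ x j) {v c : ℝ}
    (hc : 0 ≤ c)
    (H : ∀ (a : Fin n → E n) (u : Fin n → ℝ), LinearIndependent ℝ a →
      (∀ i, a i ∈ intLattice n) → (∀ i, 0 < u i) → (∀ i, ∀ x ∈ S, inner ℝ x (a i) ≤ u i) →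
      v ≤ c * ∏ i, u i) :
    v ≤ c * succMinProd (polar S) := by
  rw [succMinProd_eq_prod_fin]
  have hcont : Continuous fun ε : ℝ => c * ∏ i : Fin n, (succMin (i + 1) (polar S) + ε) := by
    fun_prop
  have hlim := (hcont.tendsto 0).mono_left (nhdsWithin_le_nhds (s := Ioi 0))
  simp only [add_zero] at hlim
  refine ge_of_tendsto hlim (eventually_nhdsWithin_of_forall fun ε hε => ?_)
  obtain ⟨a, u, ha, haz, hu, hau, hlt⟩ := exists_linearIndependent_lt_succMin_add ht h hε
  refine (H a u ha haz hu hau).trans (mul_le_mul_of_nonneg_left ?_ hc)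
  exact Finset.prod_le_prod (fun i _ => (hu i).le) fun i _ => (hlt i).le

end SuccMin

/-! ### The two volume bounds -/

theorem exists_forall_abs_apply_le {n : ℕ} (K : ConvexBody (E n)) :
    ∃ t : ℝ, 0 < t ∧ ∀ x ∈ K, ∀ j, |x j| ≤ t := by
  obtain ⟨R, hR0, hR⟩ := K.isCompact.isBounded.exists_pos_norm_le
  exact ⟨R, hR0, fun x hx j => (PiLp.norm_apply_le x j).trans (hR x hx)⟩

/-- If `x₀ i` minimizes `⟨·, a i⟩` on `K`, then `(x - x₀ i) / 2` lies in the central symmetral, so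
`K` has width at most `2 * u i` along `a i`. -/
theorem vol_le_two_pow_mul_succMinProd {n : ℕ} (K : ConvexBody (E n)) :
    vol (K : Set (E n)) ≤ 2 ^ n * succMinProd (polar (centralSymmetral (K : Set (E n)))) := by
  obtain ⟨t, ht, hKt⟩ := exists_forall_abs_apply_le K
  have hmem : ∀ x ∈ K, ∀ y ∈ K, (1 / 2 : ℝ) • (x - y) ∈ centralSymmetral (K : Set (E n)) :=
    fun x hx y hy => smul_mem_smul_set (sub_mem_sub hx hy)
  refine le_mul_succMinProd_polar ht ?_ (by positivity) ?_
  · rintro _ ⟨_, ⟨x, hx, y, hy, rfl⟩, rfl⟩ j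
    have h1 := abs_le.1 (hKt x hx j)
    have h2 := abs_le.1 (hKt y hy j)
    simp
    linarith
  · intro a u ha haz hu hau
    have hmin : ∀ i, ∃ x₀ ∈ K, ∀ x ∈ K, inner ℝ x₀ (a i) ≤ inner ℝ x (a i) := fun i =>
      K.isCompact.exists_isMinOn K.nonempty
        (f := fun x => inner ℝ x (a i)) (by fun_prop)
    choose x₀ hx₀ hle using hmin
    set c : Fin n → ℝ := fun i => inner ℝ (x₀ i) (a i) / u i
    set h : (Fin n → ℝ) → ℝ≥0∞ := (Icc c (fun i => c i + 2)).indicator 1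
    have hP : 0 < ∏ i, u i := Finset.prod_pos fun i _ => hu i
    have hvol : volume (K : Set (E n)) ≤ ENNReal.ofReal (2 ^ n * ∏ i, u i) := by
      calc volume (K : Set (E n))
          = ∫⁻ x, (K : Set (E n)).indicator 1 x :=
            (lintegral_indicator_one K.isClosed.measurableSet).symm
        _ ≤ ∫⁻ x : E n, h (fun i => inner ℝ x (a i) / u i) := by
            refine lintegral_mono fun x => ?_
            refine indicator_le (g := fun x => h fun i => inner ℝ x (a i) / u i) (fun x hx => ?_) x
            have hz : (fun i => inner ℝ x (a i) / u i) ∈ Icc c (fun i => c i + 2) := by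
              refine ⟨fun i => div_le_div_of_nonneg_right (hle i x hx) (hu i).le, fun i => ?_⟩
              have h1 := hau i _ (hmem x hx (x₀ i) (hx₀ i))
              rw [real_inner_smul_left, inner_sub_left] at h1
              change inner ℝ x (a i) / u i ≤ inner ℝ (x₀ i) (a i) / u i + 2
              rw [div_add' _ _ _ (hu i).ne']
              exact div_le_div_of_nonneg_right (by linarith) (hu i).le
            exact (indicator_of_mem hz 1).ge
        _ ≤ ENNReal.ofReal (∏ i, u i) * ∫⁻ z, h z :=
            lintegral_comp_inner_div_le ha haz hu (measurable_one.indicator measurableSet_Icc)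
        _ = _ := by
            rw [lintegral_indicator_one measurableSet_Icc, Real.volume_Icc_pi,
              ENNReal.ofReal_mul (by positivity), mul_comm]
            simp [ENNReal.ofReal_pow]
    exact ENNReal.toReal_le_of_le_ofReal (by positivity) hvol

theorem ofReal_integral_le_lintegral_ofReal {α : Type*} [MeasurableSpace α] {μ : Measure α}
    {f : α → ℝ} (hf : Integrable f μ) :
    ENNReal.ofReal (∫ x, f x ∂μ) ≤ ∫⁻ x, ENNReal.ofReal (f x) ∂μ := by
  calc ENNReal.ofReal (∫ x, f x ∂μ)
      ≤ ENNReal.ofReal (∫ x, max (f x) 0 ∂μ) :=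
        ENNReal.ofReal_le_ofReal (integral_mono hf hf.pos_part fun x => le_max_left _ _)
    _ = ∫⁻ x, ENNReal.ofReal (max (f x) 0) ∂μ :=
        ofReal_integral_eq_lintegral_ofReal hf.pos_part (ae_of_all _ fun x => le_max_right _ _)
    _ = _ := by simp

theorem vol_le_of_centroid_eq_zero {n : ℕ} (K : ConvexBody (E n)) (hK : IsFull K)
    (hc : centroid (K : Set (E n)) = 0) :
    vol (K : Set (E n)) ≤
      ((n : ℝ) + 1) ^ n / (n.factorial : ℝ) * succMinProd (polar (K : Set (E n))) := by
  obtain ⟨t, ht, hKt⟩ := exists_forall_abs_apply_le K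
  have hKm : MeasurableSet (K : Set (E n)) := K.isClosed.measurableSet
  have hKfin : volume (K : Set (E n)) ≠ ∞ := K.isCompact.measure_lt_top.ne
  have hvol0 : vol (K : Set (E n)) ≠ 0 := by
    refine (ENNReal.toReal_pos ?_ hKfin).ne'
    exact (Measure.measure_pos_of_nonempty_interior _ hK).ne'
  -- Nonempty interior makes the volume nonzero, so the factor `vol⁻¹` in the centroid can be
  -- cancelled.
  have hint : ∫ x in (K : Set (E n)), x = 0 := by
    simpa [centroid, hvol0] using hc
  refine le_mul_succMinProd_polar ht (fun x hx j => (abs_le.1 (hKt x hx j)).1) (by positivity) ?_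
  intro a u ha haz hu hau
  have hP : 0 < ∏ i, u i := Finset.prod_pos fun i _ => hu i
  set g : E n → ℝ := fun x => 1 + ∑ i, inner ℝ x (a i) / u i
  set h : (Fin n → ℝ) → ℝ≥0∞ := (Iic 1).indicator fun z => ENNReal.ofReal (1 + ∑ i, z i)
  have hidx : IntegrableOn (fun x : E n => x) (K : Set (E n)) :=
    continuous_id.continuousOn.integrableOn_compact K.isCompact
  have hgint : ∫ x in (K : Set (E n)), g x = vol (K : Set (E n)) := by
    have hinner : ∀ i, ∫ x in (K : Set (E n)), inner ℝ x (a i) / u i = 0 := fun i => by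
      have h1 : ∫ x in (K : Set (E n)), inner ℝ (a i) x = 0 := by
        rw [integral_inner hidx, hint, inner_zero_right]
      simp only [integral_div, real_inner_comm (a i), h1, zero_div]
    have hii : ∀ i, IntegrableOn (fun x : E n => inner ℝ x (a i) / u i) (K : Set (E n)) :=
      fun i => Continuous.continuousOn (by fun_prop) |>.integrableOn_compact K.isCompact
    simp only [g]
    rw [integral_add (integrable_const_iff.2 (.inr ⟨by simpa using hKfin.lt_top⟩)) (integrable_finsetSum _ fun i _ => hii i),
      integral_finsetSum _ fun i _ => hii i]
    simp [hinner, vol, Measure.real]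
  have hh : Measurable h := Measurable.indicator (by fun_prop) measurableSet_Iic
  have hhint : ∫⁻ z, h z = ENNReal.ofReal (((n : ℝ) + 1) ^ n / (n.factorial : ℝ)) := by
    have h1 := lintegral_cornerSimplex n 1 (t := (n : ℝ) + 1) (by positivity)
    rw [← lintegral_indicator (measurableSet_cornerSimplex _ _)] at h1
    -- The reflection `z = 1 - y` turns `{z ≤ 1}` into the nonnegative orthant and `1 + ∑ z i` into
    -- `n + 1 - ∑ y i`; `ENNReal.ofReal` kills it outside the corner simplex of size `n + 1`.
    rw [← factorial_div_mul_succ_pow, ← h1, ← lintegral_sub_left_eq_self h 1]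
    refine lintegral_congr fun y => ?_
    by_cases hy : ∀ i, 0 ≤ y i
    · have hy1 : 1 - y ∈ Iic (1 : Fin n → ℝ) := fun i => by simpa using hy i
      have e : 1 + ∑ i, (1 - y) i = (n : ℝ) + 1 - ∑ i, y i := by
        simp [Finset.sum_sub_distrib]; ring
      by_cases hs : ∑ i, y i ≤ (n : ℝ) + 1
      · rw [indicator_of_mem (show y ∈ cornerSimplex n ((n : ℝ) + 1) from ⟨hy, hs⟩)]
        simp only [h, indicator_of_mem hy1, e, pow_one]
      · rw [indicator_of_notMem fun h => hs h.2]
        simp only [h, indicator_of_mem hy1, e]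
        exact ENNReal.ofReal_of_nonpos (by linarith)
    · rw [indicator_of_notMem fun h => hy h.1]
      simp only [h]
      rw [indicator_of_notMem]
      exact fun hmem => hy fun i => by simpa using hmem i
  have hle : ENNReal.ofReal (vol (K : Set (E n))) ≤
      ENNReal.ofReal (((n : ℝ) + 1) ^ n / (n.factorial : ℝ) * ∏ i, u i) := by
    calc ENNReal.ofReal (vol (K : Set (E n)))
        = ENNReal.ofReal (∫ x in (K : Set (E n)), g x) := by rw [hgint]
      _ ≤ ∫⁻ x in (K : Set (E n)), ENNReal.ofReal (g x) :=
          ofReal_integral_le_lintegral_ofReal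
            (Continuous.continuousOn (by fun_prop) |>.integrableOn_compact K.isCompact)
      _ ≤ ∫⁻ x : E n, h (fun i => inner ℝ x (a i) / u i) := by
          rw [← lintegral_indicator hKm]
          refine lintegral_mono fun x => ?_
          by_cases hx : x ∈ (K : Set (E n))
          · rw [indicator_of_mem hx]
            simp only [h]
            rw [indicator_of_mem]
            exact fun i => (div_le_one (hu i)).2 (hau i x hx)
          · rw [indicator_of_notMem hx]
            exact zero_le
      _ ≤ ENNReal.ofReal (∏ i, u i) * ∫⁻ z, h z := lintegral_comp_inner_div_le ha haz hu hh
      _ = _ := by rw [hhint, mul_comm, ENNReal.ofReal_mul (by positivity)]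
  exact (ENNReal.ofReal_le_ofReal_iff (by positivity)).1 hle

/-! ### Boxes: equality in (i) and unboundedness in (iii) -/

theorem isCompact_box (n : ℕ) (b : ℝ) : IsCompact {x : E n | ∀ i, x i ∈ Icc (-1) b} := by
  have h := (EuclideanSpace.equiv (Fin n) ℝ).toHomeomorph.isCompact_preimage.2
    (isCompact_Icc (a := fun _ : Fin n => (-1 : ℝ)) (b := fun _ => b))
  convert h using 1
  ext x
  simp [Pi.le_def, forall_and]

/-- The cube `[-1, b]ⁿ`. -/
def box (n : ℕ) (b : ℝ) (hb : 0 ≤ b) : ConvexBody (E n) where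
  carrier := {x | ∀ i, x i ∈ Icc (-1) b}
  convex' := fun x hx y hy s t hs ht hst i => by
    simpa using (convex_Icc (-1 : ℝ) b) (hx i) (hy i) hs ht hst
  isCompact' := isCompact_box n b
  nonempty' := ⟨0, fun i => by simpa using hb⟩

theorem mem_box {n : ℕ} {b : ℝ} {hb : 0 ≤ b} {x : E n} :
    x ∈ (box n b hb : Set (E n)) ↔ ∀ i, x i ∈ Icc (-1) b := Iff.rfl

theorem vol_box (n : ℕ) {b : ℝ} (hb : 0 ≤ b) : vol (box n b hb : Set (E n)) = (b + 1) ^ n := by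
  have h : (box n b hb : Set (E n)) =
      WithLp.ofLp ⁻¹' Icc (fun _ : Fin n => (-1 : ℝ)) (fun _ => b) := by
    ext x
    rw [mem_box]
    simp [Pi.le_def, forall_and]
  rw [vol, h, (PiLp.volume_preserving_ofLp (Fin n)).measure_preimage
    measurableSet_Icc.nullMeasurableSet, Real.volume_Icc_pi_toReal fun _ => by linarith]
  simp

theorem zero_mem_interior_box (n : ℕ) {b : ℝ} (hb : 0 < b) :
    (0 : E n) ∈ interior (box n b hb.le : Set (E n)) := by
  refine mem_interior.2 ⟨WithLp.ofLp ⁻¹' (univ.pi fun _ : Fin n => Ioo (-1) b), ?_, ?_, ?_⟩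
  · exact fun x hx i => Ioo_subset_Icc_self (hx i (mem_univ i))
  · exact (isOpen_set_pi finite_univ fun _ _ => isOpen_Ioo).preimage (by fun_prop)
  · intro i _
    simpa using hb

theorem centralSymmetral_box_subset (n : ℕ) :
    centralSymmetral (box n 1 zero_le_one : Set (E n)) ⊆ box n 1 zero_le_one := by
  rintro _ ⟨_, ⟨x, hx, y, hy, rfl⟩, rfl⟩ i
  have h1 := hx i
  have h2 := hy i
  simp only [mem_Icc] at h1 h2
  constructor <;> simp <;> linarith

/-- Inequality (i) for a cube of volume `2 ^ n` forces this. -/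
theorem one_le_succMinProd_polar_centralSymmetral_box (n : ℕ) :
    1 ≤ succMinProd (polar (centralSymmetral (box n 1 zero_le_one : Set (E n)))) := by
  have h := vol_le_two_pow_mul_succMinProd (box n 1 zero_le_one)
  rw [vol_box, one_add_one_eq_two] at h
  exact (le_mul_iff_one_le_right (by positivity)).1 h

theorem succMinProd_polar_centralSymmetral_box (n : ℕ) :
    succMinProd (polar (centralSymmetral (box n 1 zero_le_one : Set (E n)))) = 1 :=
  le_antisymm
    (succMinProd_polar_le_one fun _ hx j => (centralSymmetral_box_subset n hx j).1)
    (one_le_succMinProd_polar_centralSymmetral_box n)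

theorem succMinProd_polar_box (n : ℕ) {b : ℝ} (hb : 1 ≤ b) :
    succMinProd (polar (box n b (zero_le_one.trans hb) : Set (E n))) = 1 := by
  refine le_antisymm (succMinProd_polar_le_one fun x hx j => (hx j).1) ?_
  refine (one_le_succMinProd_polar_centralSymmetral_box n).trans
    (succMinProd_polar_mono ?_ one_pos fun x hx j => (hx j).1)
  exact fun x hx i => Icc_subset_Icc_right hb (centralSymmetral_box_subset n hx i)

/-! ### The extremal simplex in (ii) -/

theorem isCompact_centeredSimplex (n : ℕ) :
    IsCompact {x : E n | (∀ i, -1 ≤ x i) ∧ ∑ i, x i ≤ 1} := by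
  refine (isCompact_box n n).of_isClosed_subset ?_ ?_
  · have h1 : {x : E n | (∀ i, -1 ≤ x i) ∧ ∑ i, x i ≤ 1} =
        (⋂ i, {x | -1 ≤ x i}) ∩ {x | ∑ i, x i ≤ 1} := by
      ext x; simp
    rw [h1]
    exact (isClosed_iInter fun i => isClosed_le (by fun_prop) (by fun_prop)).inter
      (isClosed_le (by fun_prop) (by fun_prop))
  · rintro x ⟨hx, hs⟩ i
    refine ⟨hx i, ?_⟩
    have h1 : x i + 1 ≤ ∑ j, (x j + 1) :=
      Finset.single_le_sum (f := fun j => x j + 1) (fun j _ => by linarith [hx j])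
        (Finset.mem_univ i)
    simp [Finset.sum_add_distrib] at h1
    linarith

/-- The simplex with vertices `-(1, …, 1)` and `-(1, …, 1) + (n + 1) eᵢ`. -/
def centeredSimplex (n : ℕ) : ConvexBody (E n) where
  carrier := {x | (∀ i, -1 ≤ x i) ∧ ∑ i, x i ≤ 1}
  convex' := fun x hx y hy s t hs ht hst => by
    refine ⟨fun i => ?_, ?_⟩
    · exact (convex_Ici (-1 : ℝ)) (hx.1 i) (hy.1 i) hs ht hst
    · have h := (convex_Iic (1 : ℝ)) hx.2 hy.2 hs ht hst
      simpa [Finset.sum_add_distrib, Finset.mul_sum] using h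
  isCompact' := isCompact_centeredSimplex n
  nonempty' := ⟨0, by simp⟩

theorem mem_centeredSimplex {n : ℕ} {x : E n} :
    x ∈ (centeredSimplex n : Set (E n)) ↔ (∀ i, -1 ≤ x i) ∧ ∑ i, x i ≤ 1 := Iff.rfl

theorem isFull_centeredSimplex (n : ℕ) : IsFull (centeredSimplex n) := by
  refine ⟨0, mem_interior.2 ⟨(⋂ i, {x | -1 < x i}) ∩ {x | ∑ i, x i < 1}, ?_, ?_, ?_⟩⟩
  · rintro x ⟨hx, hs⟩
    exact ⟨fun i => (mem_iInter.1 hx i).le, hs.le⟩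
  · exact (isOpen_iInter_of_finite fun i => isOpen_lt (by fun_prop) (by fun_prop)).inter
      (isOpen_lt (by fun_prop) (by fun_prop))
  · simp

/-- Translation by `(1, …, 1)` gives the corner simplex of size `n + 1`. -/
theorem lintegral_centeredSimplex (n k : ℕ) :
    ∫⁻ x in (centeredSimplex n : Set (E n)), ENNReal.ofReal ((1 - ∑ i, x i) ^ k) =
      ENNReal.ofReal ((k.factorial : ℝ) / ((n + k).factorial : ℝ) * ((n : ℝ) + 1) ^ (n + k)) := by
  have h1 := lintegral_cornerSimplex n k (t := (n : ℝ) + 1) (by positivity)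
  have hmeas : Measurable ((cornerSimplex n ((n : ℝ) + 1)).indicator
      fun y => ENNReal.ofReal (((n : ℝ) + 1 - ∑ i, y i) ^ k)) :=
    Measurable.indicator (by fun_prop) (measurableSet_cornerSimplex _ _)
  rw [← lintegral_indicator (measurableSet_cornerSimplex _ _),
    ← lintegral_add_right_eq_self _ (1 : Fin n → ℝ)] at h1
  rw [← h1]
  refine Eq.trans ?_ ((PiLp.volume_preserving_ofLp (Fin n)).lintegral_comp
    (hmeas.comp (measurable_add_const 1)))
  rw [← lintegral_indicator (centeredSimplex n).isClosed.measurableSet]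
  refine lintegral_congr fun x => ?_
  have hiff : x ∈ (centeredSimplex n : Set (E n)) ↔
      WithLp.ofLp x + 1 ∈ cornerSimplex n ((n : ℝ) + 1) := by
    simp only [mem_centeredSimplex, cornerSimplex, mem_ofPred_eq, Pi.add_apply, Pi.one_apply,
      Finset.sum_add_distrib]
    simp only [neg_le_iff_add_nonneg, Finset.sum_const, Finset.card_univ, Fintype.card_fin,
      nsmul_eq_mul, mul_one]
    rw [add_comm (n : ℝ) 1, add_le_add_iff_right]
  by_cases hx : x ∈ (centeredSimplex n : Set (E n))
  · rw [indicator_of_mem hx, indicator_of_mem (hiff.1 hx)]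
    congr 2
    simp [Finset.sum_add_distrib]
    ring
  · rw [indicator_of_notMem hx, indicator_of_notMem (hx ∘ hiff.2)]

theorem vol_centeredSimplex (n : ℕ) :
    vol (centeredSimplex n : Set (E n)) = ((n : ℝ) + 1) ^ n / (n.factorial : ℝ) := by
  have h := lintegral_centeredSimplex n 0
  simp only [pow_zero, ENNReal.ofReal_one, lintegral_one, Measure.restrict_apply, MeasurableSet.univ,
    univ_inter, add_zero, Nat.factorial_zero, Nat.cast_one] at h
  rw [vol, h, ENNReal.toReal_ofReal (by positivity)]
  ring

/-- The moments `k = 0` and `k = 1` coincide, so `1` and `1 - ∑ x i` have the same integral. -/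
theorem integral_sum_centeredSimplex (n : ℕ) :
    ∫ x in (centeredSimplex n : Set (E n)), ∑ i, x i = 0 := by
  have hfin : volume (centeredSimplex n : Set (E n)) ≠ ∞ :=
    (centeredSimplex n).isCompact.measure_lt_top.ne
  have hI : IntegrableOn (fun x : E n => ∑ i, x i) (centeredSimplex n) :=
    Continuous.continuousOn (by fun_prop) |>.integrableOn_compact (centeredSimplex n).isCompact
  have hI1 : IntegrableOn (fun _ : E n => (1 : ℝ)) (centeredSimplex n) :=
    integrable_const_iff.2 (.inr ⟨by simpa using hfin.lt_top⟩)
  have h := lintegral_centeredSimplex n 1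
  simp only [pow_one] at h
  rw [← ofReal_integral_eq_lintegral_ofReal
    (f := fun x : E n => 1 - ∑ i, x i) (hI1.sub hI)] at h
  · have hnn : 0 ≤ ∫ x in (centeredSimplex n : Set (E n)), (1 - ∑ i, x i) :=
      setIntegral_nonneg (centeredSimplex n).isClosed.measurableSet fun x hx => sub_nonneg.2 hx.2
    have h2 := (ENNReal.ofReal_eq_ofReal_iff hnn (by positivity)).1 h
    rw [integral_sub hI1 hI] at h2
    have hv := vol_centeredSimplex n
    simp only [integral_const, MeasurableSet.univ, measureReal_restrict_apply, univ_inter,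
      smul_eq_mul, mul_one] at h2
    rw [vol] at hv
    rw [factorial_div_mul_succ_pow, Measure.real, hv] at h2
    linarith
  · exact (ae_restrict_iff' (centeredSimplex n).isClosed.measurableSet).2
      (ae_of_all _ fun x hx => sub_nonneg.2 hx.2)

/-- Swapping two coordinates is an isometry preserving the simplex. -/
theorem integral_apply_centeredSimplex_eq (n : ℕ) (i j : Fin n) :
    ∫ x in (centeredSimplex n : Set (E n)), x i = ∫ x in (centeredSimplex n : Set (E n)), x j := by
  set e := LinearIsometryEquiv.piLpCongrLeft 2 ℝ ℝ (Equiv.swap i j)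
  have he : ∀ (x : E n) k, e x k = x (Equiv.swap i j k) := fun x k => by
    simp [e, LinearIsometryEquiv.piLpCongrLeft_apply]
  have hpre : e ⁻¹' (centeredSimplex n : Set (E n)) = centeredSimplex n := by
    ext x
    simp only [mem_preimage, mem_centeredSimplex, he]
    rw [Equiv.sum_comp (Equiv.swap i j) fun k => x k,
      (Equiv.swap i j).forall_congr_left (p := fun k => -1 ≤ x (Equiv.swap i j k))]
    simp
  have h := e.measurePreserving.setIntegral_preimage_emb
    e.toHomeomorph.measurableEmbedding (fun x => x i) (centeredSimplex n : Set (E n))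
  rw [hpre] at h
  rw [← h]
  simp [he]

theorem centroid_centeredSimplex (n : ℕ) : centroid (centeredSimplex n : Set (E n)) = 0 := by
  have hid : IntegrableOn (fun x : E n => x) (centeredSimplex n) :=
    continuous_id.continuousOn.integrableOn_compact (centeredSimplex n).isCompact
  have hI : ∀ i, IntegrableOn (fun x : E n => x i) (centeredSimplex n) := fun i =>
    Continuous.continuousOn (by fun_prop) |>.integrableOn_compact (centeredSimplex n).isCompact
  suffices h : ∫ x in (centeredSimplex n : Set (E n)), x = 0 by rw [centroid, h, smul_zero]
  ext i
  have h1 : (∫ x in (centeredSimplex n : Set (E n)), x) i =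
      ∫ x in (centeredSimplex n : Set (E n)), x i :=
    ((EuclideanSpace.proj (𝕜 := ℝ) i).integral_comp_comm hid).symm
  have h2 := integral_sum_centeredSimplex n
  rw [integral_finsetSum _ fun i _ => hI i,
    Finset.sum_congr rfl fun j _ => integral_apply_centeredSimplex_eq n j i] at h2
  have hn : (n : ℝ) ≠ 0 := by exact_mod_cast i.pos.ne'
  rw [h1]
  simpa [hn] using h2

theorem succMinProd_polar_centeredSimplex (n : ℕ) :
    succMinProd (polar (centeredSimplex n : Set (E n))) = 1 := by
  refine le_antisymm (succMinProd_polar_le_one fun x hx j => hx.1 j) ?_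
  have h := vol_le_of_centroid_eq_zero _ (isFull_centeredSimplex n) (centroid_centeredSimplex n)
  rw [vol_centeredSimplex] at h
  exact (le_mul_iff_one_le_right (by positivity)).1 h

end ConvexLattice

theorem theorem2 (n : ℕ) (hn : 1 ≤ n) :
    -- (i) the bound for the central symmetral, with equality for some body
    ((∀ K : ConvexBody (ConvexLattice.E n), ConvexLattice.IsFull K →
        ConvexLattice.vol (K : Set (ConvexLattice.E n)) ≤
          2 ^ n * ConvexLattice.succMinProd
            (ConvexLattice.polar (ConvexLattice.centralSymmetral (K : Set (ConvexLattice.E n))))) ∧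
      (∃ K : ConvexBody (ConvexLattice.E n), ConvexLattice.IsFull K ∧
        ConvexLattice.vol (K : Set (ConvexLattice.E n)) =
          2 ^ n * ConvexLattice.succMinProd
            (ConvexLattice.polar (ConvexLattice.centralSymmetral (K : Set (ConvexLattice.E n)))))) ∧
    -- (ii) the bound for centered bodies, with equality for some centered body
    ((∀ K : ConvexBody (ConvexLattice.E n), ConvexLattice.IsFull K →
        ConvexLattice.centroid (K : Set (ConvexLattice.E n)) = 0 →
        ConvexLattice.vol (K : Set (ConvexLattice.E n)) ≤
          ((n : ℝ) + 1) ^ n / (n.factorial : ℝ) *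
            ConvexLattice.succMinProd (ConvexLattice.polar (K : Set (ConvexLattice.E n)))) ∧
      (∃ K : ConvexBody (ConvexLattice.E n), ConvexLattice.IsFull K ∧
        ConvexLattice.centroid (K : Set (ConvexLattice.E n)) = 0 ∧
        ConvexLattice.vol (K : Set (ConvexLattice.E n)) =
          ((n : ℝ) + 1) ^ n / (n.factorial : ℝ) *
            ConvexLattice.succMinProd (ConvexLattice.polar (K : Set (ConvexLattice.E n))))) ∧
    -- (iii) no function of the product bounds the volume of all bodies with `0` in the interior
    (¬ ∃ f : ℝ → ℝ, ∀ K : ConvexBody (ConvexLattice.E n),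
        (0 : ConvexLattice.E n) ∈ interior (K : Set (ConvexLattice.E n)) →
        ConvexLattice.vol (K : Set (ConvexLattice.E n)) ≤
          f (ConvexLattice.succMinProd (ConvexLattice.polar (K : Set (ConvexLattice.E n))))) := by
  open ConvexLattice in
  refine ⟨⟨fun K _ => vol_le_two_pow_mul_succMinProd K, box n 1 zero_le_one,
    ⟨0, zero_mem_interior_box n one_pos⟩, ?_⟩,
    ⟨fun K => vol_le_of_centroid_eq_zero K, centeredSimplex n, isFull_centeredSimplex n,
      centroid_centeredSimplex n, ?_⟩, ?_⟩
  · rw [vol_box, succMinProd_polar_centralSymmetral_box, one_add_one_eq_two, mul_one]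
  · rw [vol_centeredSimplex, succMinProd_polar_centeredSimplex, mul_one]
  · rintro ⟨f, hf⟩
    -- With `b = max 1 (f 1)` the product is 1, while the volume is `(b + 1) ^ n ≥ b + 1 > f 1`.
    have hb : 1 ≤ max 1 (f 1) := le_max_left _ _
    have h := hf (box n _ (zero_le_one.trans hb)) (zero_mem_interior_box n (one_pos.trans_le hb))
    rw [vol_box, succMinProd_polar_box n hb] at h
    have h1 := le_self_pow₀ (a := max 1 (f 1) + 1) (by linarith) (Nat.one_le_iff_ne_zero.1 hn)
    linarith [le_max_right 1 (f 1)]
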